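/- Let $N,m\ge 1$ be integers with $2m\le N+1$, let $\lambda\in\mathbb{R}$ and $\alpha_1,\dots,\alpha_m>0$, and set, for $1\le k\le m$, $$\widetilde\alpha_k \;=\; \alpha_k + N^{-1}\lambda^2\,\tfrac{k-2}{2}\,\alpha_k - N^{-1}\tfrac{\lambda^2}{k}\sum_{\ell=k+1}^{m}(2\ell-k)\,\alpha_\ell .$$ Assume $\widetilde\alpha_1>0$ and $\widetilde\alpha_k\ge 0$ for $1\le k\le m$. Write $[\![a,b]\!]$ for the set of integers $a\le x\le b$. For functions $\varphi$ on $[\![0,N]\!]$ write $\nabla_k\varphi_x=\varphi_{x+k}-\varphi_x$, $\Delta_k\varphi_x=\varphi_{x+k}+\varphi_{x-k}-2\varphi_x$, $\nabla_k^{!}=N\nabla_k$, $\Delta_k^{!!}=N^2\Delta_k$, and let $$\begin{aligned}\mathscr{L}\varphi_x \;=\;& \mathbf 1_{x\in[\![m,N-m]\!]}\,\tfrac12\sum_{k=1}^m\widetilde\alpha_k\Delta_k^{!!}\varphi_x + \mathbf 1_{x\in[\![0,m-1]\!]}\,\tfrac12\sum_{k=1}^m N\widetilde\alpha_k\big(\nabla_k^{!}+\nabla_{-(k\wedge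 x)}^{!}\big)\varphi_x\\ &+ \mathbf 1_{x\in[\![N-m+1,N]\!]}\,\tfrac12\sum_{k=1}^m N\widetilde\alpha_k\big(\nabla_{-k}^{!}+\nabla_{k\wedge(N-x)}^{!}\big)\varphi_x .\end{aligned}$$ Let $\mathscr{U}^{N,0}_{S,T,x,y}$ ($0\le S\le T$, $x,y\in[\![0,N]\!]$) be the Neumann heat kernel of $\mathscr{L}$, that is, the solution of $\partial_T\mathscr{U}^{N,0}_{S,T,x,y}=\mathscr{L}\,\mathscr{U}^{N,0}_{S,T,x,y}$ (with $\mathscr{L}$ acting on $x$), $\mathscr{U}^{N,0}_{S,S,x,y}=\mathbf 1_{x=y}$, with the ghost values $\mathscr{U}^{N,0}_{S,T,-1,y}=\mathscr{U}^{N,0}_{S,T,0,y}$ and $\mathscr{U}^{N,0}_{S,T,N+1,y}=\mathscr{U}^{N,0}_{S,T,N,y}$. Then there is a constant $C=C(m,\widetilde\alpha_1,T_f)$, depending only on $m$, $\widetilde\alpha_1$ and $T_f$, such that for all $0\le S\le T\le T_f$ and all $x,y\in[\![0,N]\!]$, $$0\;\le\;\mathscr{U}^{N,0}_{S,T,x,y}\;\le\;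 C\,\Big(\big[N^{-1}+N^{-1}|T-S|^{-1/2}\big]\wedge 1\Big),$$ where for $S=T$ the right-hand side is read as $C$. -/

import Mathlib

open scoped BigOperators

namespace LongRangeHeat

/-- The modified jump coefficients
`α̃_k = α_k + N⁻¹ λ² ((k-2)/2) α_k - N⁻¹ (λ²/k) ∑_{ℓ=k+1}^{m} (2ℓ-k) α_ℓ`,
built from the symmetric jump rates `α_1, …, α_m`. -/
noncomputable def alphaTilde (N m : ℕ) (lam : ℝ) (α : ℕ → ℝ) (k : ℕ) : ℝ :=
  α k + (N : ℝ)⁻¹ * lam ^ 2 * (((k : ℝ) - 2) / 2) * α k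
    - (N : ℝ)⁻¹ * (lam ^ 2 / (k : ℝ)) * ∑ l ∈ Finset.Icc (k + 1) m, (2 * (l : ℝ) - (k : ℝ)) * α l

/-- The rescaled discrete gradient `∇_k^! φ_x = N (φ_{x+k} - φ_x)`, for `k ∈ ℤ`. -/
def gradS (N : ℕ) (k : ℤ) (φ : ℤ → ℝ) (x : ℤ) : ℝ :=
  (N : ℝ) * (φ (x + k) - φ x)

/-- The rescaled discrete Laplacian `Δ_k^{!!} φ_x = N² (φ_{x+k} + φ_{x-k} - 2 φ_x)`. -/
def lapS (N : ℕ) (k : ℤ) (φ : ℤ → ℝ) (x : ℤ) : ℝ :=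
  (N : ℝ) ^ 2 * (φ (x + k) + φ (x - k) - 2 * φ x)

/-- The long-range operator on `⟦0,N⟧` with maximal jump-length `m` and coefficients `a k`,
`1 ≤ k ≤ m`: the long-range Laplacian in the bulk `⟦m,N-m⟧`; near the left edge `⟦0,m-1⟧` and the
right edge `⟦N-m+1,N⟧`, jumps that would leave `⟦0,N⟧` are shortened so as to end at the
nearest edge point. For `2 * m ≤ N + 1` the three regions are disjoint, and for `x ∈ ⟦0,N⟧`
the value at `x` involves only the values of `φ` on `⟦0,N⟧`. -/
noncomputable def lapOp (N m : ℕ) (a : ℕ → ℝ) (φ : ℤ → ℝ) (x : ℤ) : ℝ :=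
  (if x ∈ Set.Icc (m : ℤ) ((N : ℤ) - m) then
      (1 / 2) * ∑ k ∈ Finset.Icc 1 m, a k * lapS N k φ x else 0)
  + (if x ∈ Set.Icc (0 : ℤ) ((m : ℤ) - 1) then
      (1 / 2) * ∑ k ∈ Finset.Icc 1 m, (N : ℝ) * a k * gradS N k φ x else 0)
  + (if x ∈ Set.Icc (0 : ℤ) ((m : ℤ) - 1) then
      (1 / 2) * ∑ k ∈ Finset.Icc 1 m, (N : ℝ) * a k * gradS N (-(min (k : ℤ) x)) φ x else 0)
  + (if x ∈ Set.Icc ((N : ℤ) - m + 1) (N : ℤ) then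
      (1 / 2) * ∑ k ∈ Finset.Icc 1 m, (N : ℝ) * a k * gradS N (-(k : ℤ)) φ x else 0)
  + (if x ∈ Set.Icc ((N : ℤ) - m + 1) (N : ℤ) then
      (1 / 2) * ∑ k ∈ Finset.Icc 1 m, (N : ℝ) * a k * gradS N (min (k : ℤ) ((N : ℤ) - x)) φ x
      else 0)

/-- `U S T x y` is the Neumann heat kernel of `lapOp N m a` on `⟦0,N⟧`: for every starting time
`S ≥ 0` and every `y`, the function `(T, x) ↦ U S T x y` solves the heat equation for `T ≥ S`
(with the operator acting on the variable `x`), starts from the indicator of `y`, and satisfies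
the Neumann conditions at the ghost sites `-1` and `N+1`. -/
structure IsNeumannHeatKernel (N m : ℕ) (a : ℕ → ℝ) (U : ℝ → ℝ → ℤ → ℤ → ℝ) : Prop where
  heat : ∀ S T : ℝ, 0 ≤ S → S ≤ T → ∀ x ∈ Set.Icc (0 : ℤ) N, ∀ y ∈ Set.Icc (0 : ℤ) N,
    HasDerivWithinAt (fun t => U S t x y) (lapOp N m a (fun z => U S T z y) x) (Set.Ici S) T
  init : ∀ S : ℝ, 0 ≤ S → ∀ x ∈ Set.Icc (0 : ℤ) N, ∀ y ∈ Set.Icc (0 : ℤ) N,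
    U S S x y = if x = y then 1 else 0
  left : ∀ S T : ℝ, 0 ≤ S → S ≤ T → ∀ y ∈ Set.Icc (0 : ℤ) N, U S T (-1) y = U S T 0 y
  right : ∀ S T : ℝ, 0 ≤ S → S ≤ T → ∀ y ∈ Set.Icc (0 : ℤ) N,
    U S T ((N : ℤ) + 1) y = U S T N y

/-- The envelope `[N⁻¹ + N⁻¹ |T - S|^{-1/2}] ∧ 1`; at `T = S`, where `|T - S|^{-1/2} = +∞`,
it equals `1`. -/
noncomputable def envelope (N : ℕ) (S T : ℝ) : ℝ :=
  if S = T then 1 else min ((N : ℝ)⁻¹ + (N : ℝ)⁻¹ * |T - S| ^ (-(1 / 2) : ℝ)) 1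

/-- The point of `⟦0,N⟧` nearest to `z`. -/
def clampFin (N : ℕ) (z : ℤ) : Fin (N + 1) :=
  ⟨min z.toNat N, Nat.lt_succ_of_le (min_le_right _ _)⟩

theorem lapOp_add (N m : ℕ) (a : ℕ → ℝ) (φ ψ : ℤ → ℝ) (x : ℤ) :
    lapOp N m a (fun z => φ z + ψ z) x = lapOp N m a φ x + lapOp N m a ψ x := by
  have h1 : ∀ k : ℤ, lapS N k (fun z => φ z + ψ z) x = lapS N k φ x + lapS N k ψ x := by
    intro k; simp only [lapS]; ring
  have h2 : ∀ k : ℤ, gradS N k (fun z => φ z + ψ z) x = gradS N k φ x + gradS N k ψ x := by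
    intro k; simp only [gradS]; ring
  simp only [lapOp, h1, h2, mul_add, Finset.sum_add_distrib]
  split_ifs <;> ring

theorem lapOp_const_mul (N m : ℕ) (a : ℕ → ℝ) (c : ℝ) (φ : ℤ → ℝ) (x : ℤ) :
    lapOp N m a (fun z => c * φ z) x = c * lapOp N m a φ x := by
  have h1 : ∀ k : ℤ, lapS N k (fun z => c * φ z) x = c * lapS N k φ x := by
    intro k; simp only [lapS]; ring
  have h2 : ∀ k : ℤ, gradS N k (fun z => c * φ z) x = c * gradS N k φ x := by
    intro k; simp only [gradS]; ring
  simp only [lapOp, h1, h2, mul_left_comm _ c, ← Finset.mul_sum]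
  split_ifs <;> ring

/-- The Neumann heat kernel exists. -/
theorem exists_isNeumannHeatKernel (N m : ℕ) (a : ℕ → ℝ) :
    ∃ U : ℝ → ℝ → ℤ → ℤ → ℝ, IsNeumannHeatKernel N m a U := by
  let L : (Fin (N + 1) → ℝ) →ₗ[ℝ] (Fin (N + 1) → ℝ) :=
    { toFun := fun v i => lapOp N m a (fun z => v (clampFin N z)) (i : ℕ)
      map_add' := fun v w => funext fun i =>
        lapOp_add N m a (fun z => v (clampFin N z)) (fun z => w (clampFin N z)) (i : ℕ)
      map_smul' := fun c v => funext fun i =>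
        lapOp_const_mul N m a c (fun z => v (clampFin N z)) (i : ℕ) }
  let A : (Fin (N + 1) → ℝ) →L[ℝ] (Fin (N + 1) → ℝ) := LinearMap.toContinuousLinearMap L
  let e : ℤ → (Fin (N + 1) → ℝ) := fun y => Pi.single (clampFin N y) 1
  have hc : ∀ x ∈ Set.Icc (0 : ℤ) N, (((clampFin N x : Fin (N + 1)) : ℕ) : ℤ) = x := by
    intro x hx
    obtain ⟨h0, h1⟩ := hx
    simp only [clampFin]
    omega
  refine ⟨fun S T x y => (NormedSpace.exp ((T - S) • A)) (e y) (clampFin N x), ?_, ?_, ?_, ?_⟩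
  · intro S T _ _ x hx y _
    have h1 : HasDerivAt (fun t : ℝ => NormedSpace.exp ((t - S) • A))
        (A * NormedSpace.exp ((T - S) • A)) T := by
      have := (hasDerivAt_exp_smul_const' (𝕂 := ℝ) A (T - S)).scomp T
        ((hasDerivAt_id T).sub_const S)
      rw [one_smul] at this
      exact this
    have h2 := h1.clm_apply (hasDerivAt_const T (e y))
    have h3 := (hasDerivAt_pi.1 h2) (clampFin N x)
    refine HasDerivAt.hasDerivWithinAt ?_
    convert h3 using 1
    simp only [map_zero, add_zero, mul_apply_eq_comp]
    change _ = lapOp N m a _ _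
    rw [hc x hx]
  · intro S _ x hx y hy
    simp only [sub_self, zero_smul, NormedSpace.exp_zero, one_apply_eq_self, e]
    rw [Pi.single_apply]
    congr 1
    apply propext
    rw [← hc x hx, ← hc y hy]
    constructor
    · intro h
      have := congrArg (fun i : Fin (N + 1) => ((i : ℕ) : ℤ)) h
      rw [hc x hx, hc y hy] at *
      simpa [hc x hx, hc y hy] using this
    · intro h
      rw [hc x hx, hc y hy] at h
      rw [h]
  · intro S T _ _ y _
    rfl
  · intro S T _ _ y _
    have : clampFin N ((N : ℤ) + 1) = clampFin N N := by
      apply Fin.ext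
      simp only [clampFin]
      omega
    simp only [this]

end LongRangeHeat

/-! The operator generates the symmetric walk on `⟦0,N⟧` whose jumps are clamped at the edges, so
the kernel is `P_x(X_t = y) = v_t(y) - v_t(y+1)` with `v_t(y) = P_x(X_t ≥ y)`. By Siegmund duality
(`isDirichletFlow_heatFlow`), `v` as a function of the threshold `y` solves the heat equation of the
unclamped walk on `⟦1,N⟧`, with boundary values `1` on the left and `0` on the right. The bound thus
becomes a modulus of continuity for a monotone Dirichlet solution.

That modulus comes from doubling variables (`IsDirichletFlow.sub_le_barrier`): `v_t(y) - v_t(z)` is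
compared, by the maximum principle on pairs `y < z`, with a concave supersolution of `z - y + m`.
The barrier is `e / N` plus a parabola rising from `0` to `1` over a radius of order `√(1 + c t)`,
where `c = N² α̃₁ / 2`. Jumps `k ≥ 2` are moved in parallel and contribute nothing harmful; only the
nearest-neighbour jumps, moved in mirror image, are used, so of the coefficients only `α̃₁` enters
the constant. Pairs reaching outside `⟦1,N⟧` are covered by `IsDirichletFlow.one_sub_le_barrier` and
reflection. Taking `z = y + 1` gives the theorem. -/

open Filter Topology Set

namespace LongRangeHeat

/-! ### Maximum principle for finite systems of differential equations. -/

/-- Maximum principle for finite systems: if no component can cross zero from below, all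
components stay nonpositive. -/
theorem nonpos_of_forall_deriv_neg {ι : Type*} (s : Finset ι) (f f' : ι → ℝ → ℝ)
    (hderiv : ∀ t, 0 ≤ t → ∀ i ∈ s, HasDerivAt (f i) (f' i t) t)
    (hinit : ∀ i ∈ s, f i 0 ≤ 0)
    (hneg : ∀ t, 0 ≤ t → (∀ j ∈ s, f j t ≤ 0) → ∀ i ∈ s, f i t = 0 → f' i t < 0)
    {t : ℝ} (ht : 0 ≤ t) {i : ι} (hi : i ∈ s) : f i t ≤ 0 := by
  have hclosed : IsClosed ({τ | ∀ j ∈ s, f j τ ≤ 0} ∩ Icc 0 t) := by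
    have : ({τ | ∀ j ∈ s, f j τ ≤ 0} ∩ Icc 0 t) = Icc 0 t ∩ ⋂ j ∈ s, {τ ∈ Icc 0 t | f j τ ≤ 0} := by
      ext τ
      simp only [mem_inter_iff, mem_ofPred_eq, mem_iInter]
      exact ⟨fun h => ⟨h.2, fun j hj => ⟨h.2, h.1 j hj⟩⟩, fun h => ⟨fun j hj => (h.2 j hj).2, h.1⟩⟩
    rw [this]
    refine isClosed_Icc.inter (isClosed_biInter fun j hj => ?_)
    exact isClosed_Icc.isClosed_le
      (fun τ hτ => (hderiv τ hτ.1 j hj).continuousAt.continuousWithinAt) continuousOn_const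
  -- Continuous induction: the good times form a closed set, and each good time is followed by
  -- another one arbitrarily close.
  refine hclosed.Icc_subset_of_forall_exists_gt (a := 0) (b := t) hinit ?_ ⟨ht, le_rfl⟩ i hi
  rintro τ ⟨hτ, hτ0, -⟩ y hy
  have hev : ∀ j ∈ s, ∀ᶠ σ in 𝓝[>] τ, f j σ ≤ 0 := by
    intro j hj
    rcases (hτ j hj).lt_or_eq with h | h
    · exact (((hderiv τ hτ0 j hj).continuousAt.eventually_lt_const h).filter_mono
        nhdsWithin_le_nhds).mono fun σ hσ => hσ.le
    · have hs := (hasDerivAt_iff_tendsto_slope.1 (hderiv τ hτ0 j hj)).mono_left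
        (nhdsWithin_mono τ fun σ (hσ : τ < σ) => hσ.ne')
      filter_upwards [hs.eventually_lt_const (hneg τ hτ0 hτ j hj h), self_mem_nhdsWithin]
        with σ hσ hlt
      rw [slope_def_field, h, sub_zero] at hσ
      have hlt : τ < σ := hlt
      by_contra! hpos
      exact absurd hσ (not_lt.2 (div_nonneg hpos.le (sub_nonneg.2 hlt.le)))
  obtain ⟨σ, h1, h2⟩ := (((Filter.eventually_all_finset s).2 hev).and
    (Ioc_mem_nhdsGT hy)).exists
  exact ⟨σ, h1, h2⟩

/-! ### The clamped walk and its semigroup. -/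

/-- The point of `⟦0,N⟧` nearest to `z`, as an integer. -/
def clamp (N : ℕ) (z : ℤ) : ℤ := max 0 (min z N)

theorem coe_clampFin (N : ℕ) (z : ℤ) : ((clampFin N z : ℕ) : ℤ) = clamp N z := by
  simp only [clampFin, clamp]
  omega

theorem clampFin_coe (N : ℕ) (i : Fin (N + 1)) : clampFin N (i : ℕ) = i := by
  apply Fin.ext
  simp only [clampFin]
  omega

/-- The operator is the generator of the symmetric walk truncated at the edges of `⟦0,N⟧`. -/
theorem lapOp_eq_sum_clamp {N m : ℕ} (hmN : 2 * m ≤ N + 1) (a : ℕ → ℝ) (φ : ℤ → ℝ) {x : ℤ}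
    (hx : x ∈ Icc (0 : ℤ) N) :
    lapOp N m a φ x = ∑ k ∈ Finset.Icc 1 m, (N : ℝ) ^ 2 * a k / 2 *
      (φ (clamp N (x + k)) + φ (clamp N (x - k)) - 2 * φ x) := by
  obtain ⟨h0, h1⟩ := hx
  -- Since `2 * m ≤ N + 1`, only one region's indicators survive, and near an edge only the jump
  -- towards that edge can be clamped: `x ≤ m - 1` gives `x + k ≤ 2 * m - 1 ≤ N`.
  have hcase : (m ≤ x ∧ x ≤ N - m) ∨ x ≤ m - 1 ∨ N - m + 1 ≤ x := by omega
  rcases hcase with h | h | h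
  · have e2 : ¬ (x ≤ (m : ℤ) - 1) := by omega
    have e3 : ¬ ((N : ℤ) - m + 1 ≤ x) := by omega
    simp only [lapOp, mem_Icc, h, h0, e2, e3, and_true, and_false, false_and, if_true, if_false,
      add_zero, Finset.mul_sum]
    refine Finset.sum_congr rfl fun k hk => ?_
    rw [Finset.mem_Icc] at hk
    rw [show clamp N (x + k) = x + k by simp only [clamp]; omega,
      show clamp N (x - k) = x - k by simp only [clamp]; omega]
    simp only [lapS]
    ring
  · have e2 : ¬ ((m : ℤ) ≤ x) := by omega
    have e3 : ¬ ((N : ℤ) - m + 1 ≤ x) := by omega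
    simp only [lapOp, mem_Icc, h, h0, e2, e3, and_true, false_and, if_true, if_false,
      add_zero, zero_add, Finset.mul_sum, ← Finset.sum_add_distrib]
    refine Finset.sum_congr rfl fun k hk => ?_
    rw [Finset.mem_Icc] at hk
    rw [show clamp N (x + k) = x + k by simp only [clamp]; omega,
      show clamp N (x - k) = x + -(min (k : ℤ) x) by simp only [clamp]; omega]
    simp only [gradS]
    ring
  · have e2 : ¬ (x ≤ (N : ℤ) - m) := by omega
    have e3 : ¬ (x ≤ (m : ℤ) - 1) := by omega
    simp only [lapOp, mem_Icc, h, h1, e2, e3, and_true, and_false, if_true, if_false,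
      add_zero, zero_add, Finset.mul_sum, ← Finset.sum_add_distrib]
    refine Finset.sum_congr rfl fun k hk => ?_
    rw [Finset.mem_Icc] at hk
    rw [show clamp N (x + k) = x + min (k : ℤ) (N - x) by simp only [clamp]; omega,
      show clamp N (x - k) = x + -(k : ℤ) by simp only [clamp]; omega]
    simp only [gradS]
    ring

/-- The operator `lapOp` on functions on `⟦0,N⟧`. -/
noncomputable def lapCLM (N m : ℕ) (a : ℕ → ℝ) :
    (Fin (N + 1) → ℝ) →L[ℝ] (Fin (N + 1) → ℝ) :=
  LinearMap.toContinuousLinearMap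
    { toFun := fun v i => lapOp N m a (fun z => v (clampFin N z)) (i : ℕ)
      map_add' := fun v w => funext fun i =>
        lapOp_add N m a (fun z => v (clampFin N z)) (fun z => w (clampFin N z)) (i : ℕ)
      map_smul' := fun c v => funext fun i =>
        lapOp_const_mul N m a c (fun z => v (clampFin N z)) (i : ℕ) }

theorem lapCLM_apply {N m : ℕ} (hmN : 2 * m ≤ N + 1) (a : ℕ → ℝ) (v : Fin (N + 1) → ℝ)
    (i : Fin (N + 1)) :
    lapCLM N m a v i = ∑ k ∈ Finset.Icc 1 m, (N : ℝ) ^ 2 * a k / 2 *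
      (v (clampFin N ((i : ℕ) + k)) + v (clampFin N ((i : ℕ) - k)) - 2 * v i) := by
  have hi : ((i : ℕ) : ℤ) ∈ Icc (0 : ℤ) N := ⟨by omega, by have := i.2; omega⟩
  have hcc : ∀ z, clampFin N (clamp N z) = clampFin N z := by
    intro z
    apply Fin.ext
    simp only [clampFin, clamp]
    omega
  change lapOp N m a (fun z => v (clampFin N z)) (i : ℕ) = _
  rw [lapOp_eq_sum_clamp hmN a _ hi]
  simp only [hcc, clampFin_coe]

/-- The semigroup generated by `lapOp` on functions on `⟦0,N⟧`. -/
noncomputable def heatFlow (N m : ℕ) (a : ℕ → ℝ) (t : ℝ) :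
    (Fin (N + 1) → ℝ) →L[ℝ] (Fin (N + 1) → ℝ) :=
  NormedSpace.exp (t • lapCLM N m a)

theorem heatFlow_zero (N m : ℕ) (a : ℕ → ℝ) (v : Fin (N + 1) → ℝ) : heatFlow N m a 0 v = v := by
  simp [heatFlow]

theorem hasDerivAt_heatFlow (N m : ℕ) (a : ℕ → ℝ) (v : Fin (N + 1) → ℝ) (t : ℝ) :
    HasDerivAt (fun s => heatFlow N m a s v) (lapCLM N m a (heatFlow N m a t v)) t := by
  have h := (hasDerivAt_exp_smul_const' (𝕂 := ℝ) (lapCLM N m a) t).clm_apply (hasDerivAt_const t v)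
  exact h.congr_deriv (by simp [heatFlow])

/-- Letting the generator fall on the initial datum is what turns the equation in `x` into one in
the threshold `y`. -/
theorem hasDerivAt_heatFlow' (N m : ℕ) (a : ℕ → ℝ) (v : Fin (N + 1) → ℝ) (t : ℝ) :
    HasDerivAt (fun s => heatFlow N m a s v) (heatFlow N m a t (lapCLM N m a v)) t := by
  have h := (hasDerivAt_exp_smul_const (𝕂 := ℝ) (lapCLM N m a) t).clm_apply (hasDerivAt_const t v)
  exact h.congr_deriv (by simp [heatFlow])

/-- The Neumann heat kernel is given by the semigroup. -/
theorem IsNeumannHeatKernel.eq_heatFlow {N m : ℕ} (hmN : 2 * m ≤ N + 1) {a : ℕ → ℝ}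
    {U : ℝ → ℝ → ℤ → ℤ → ℝ} (hU : IsNeumannHeatKernel N m a U) {S T : ℝ} (hS : 0 ≤ S)
    (hST : S ≤ T) {x y : ℤ} (hx : x ∈ Icc (0 : ℤ) N) (hy : y ∈ Icc (0 : ℤ) N) :
    U S T x y = heatFlow N m a (T - S) (Pi.single (clampFin N y) 1) (clampFin N x) := by
  have hc : ∀ z ∈ Icc (0 : ℤ) N, ((clampFin N z : ℕ) : ℤ) = z := by
    intro z hz
    obtain ⟨h0, h1⟩ := hz
    rw [coe_clampFin, clamp]
    omega
  have hmem : ∀ i : Fin (N + 1), ((i : ℕ) : ℤ) ∈ Icc (0 : ℤ) N := fun i =>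
    ⟨by omega, by have := i.2; omega⟩
  have hderivU : ∀ t, S ≤ t → HasDerivWithinAt (fun s (i : Fin (N + 1)) => U S s (i : ℕ) y)
      (lapCLM N m a fun i => U S t (i : ℕ) y) (Ici S) t := by
    intro t ht
    rw [hasDerivWithinAt_pi]
    intro i
    refine (hU.heat S t hS ht _ (hmem i) y hy).congr_deriv ?_
    rw [lapOp_eq_sum_clamp hmN a _ (hmem i), lapCLM_apply hmN]
    simp only [coe_clampFin]
  have hderivP : ∀ t, HasDerivAt (fun s => heatFlow N m a (s - S) (Pi.single (clampFin N y) 1))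
      (lapCLM N m a (heatFlow N m a (t - S) (Pi.single (clampFin N y) 1))) t := fun t =>
    (hasDerivAt_heatFlow N m a _ (t - S)).comp_sub_const t S
  -- Clamping makes the equation a closed linear system on `⟦0,N⟧`, so Lipschitz uniqueness applies.
  have key := ODE_solution_unique_of_mem_Icc_right (v := fun _ => lapCLM N m a)
    (s := fun _ => univ) (a := S) (b := T) (K := ‖lapCLM N m a‖₊)
    (fun t _ => (lapCLM N m a).lipschitz.lipschitzOnWith)
    (fun t ht => ((hderivU t ht.1).continuousWithinAt).mono Icc_subset_Ici_self)
    (fun t ht => (hderivU t ht.1).mono (Ici_subset_Ici.2 ht.1)) (fun _ _ => mem_univ _)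
    (fun t _ => (hderivP t).continuousAt.continuousWithinAt)
    (fun t _ => (hderivP t).hasDerivWithinAt) (fun _ _ => mem_univ _)
    (by
      funext i
      rw [hU.init S hS _ (hmem i) y hy, sub_self, heatFlow_zero, Pi.single_apply]
      congr 1
      rw [Fin.ext_iff, ← hc y hy, coe_clampFin, ← coe_clampFin, eq_iff_iff]
      simp only [← Nat.cast_inj (R := ℤ), coe_clampFin]
      have := hc y hy
      rw [coe_clampFin] at this
      rw [this, this])
  have := congrFun (key (right_mem_Icc.2 hST)) (clampFin N x)
  simpa only [hc x hx] using this

/-- The slack `ε * (1 + t)` makes the maximum principle strict: at a contact point the flow is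
minimal, so the generator is nonnegative there while the slack still grows. -/
theorem heatFlow_nonneg {N m : ℕ} (hmN : 2 * m ≤ N + 1) {a : ℕ → ℝ}
    (ha : ∀ k ∈ Finset.Icc 1 m, 0 ≤ a k) {v : Fin (N + 1) → ℝ} (hv : ∀ i, 0 ≤ v i) {t : ℝ}
    (ht : 0 ≤ t) (i : Fin (N + 1)) : 0 ≤ heatFlow N m a t v i := by
  have key : ∀ ε : ℝ, 0 < ε → -heatFlow N m a t v i - ε * (1 + t) ≤ 0 := by
    intro ε hε
    refine nonpos_of_forall_deriv_neg Finset.univ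
      (fun j s => -heatFlow N m a s v j - ε * (1 + s))
      (fun j s => -lapCLM N m a (heatFlow N m a s v) j - ε) ?_ ?_ ?_ ht (Finset.mem_univ i)
    · intro s _ j _
      have h := ((hasDerivAt_pi.1 (hasDerivAt_heatFlow N m a v s)) j).neg.sub
        (((hasDerivAt_id s).const_add 1).const_mul ε)
      exact h.congr_deriv (by simp)
    · intro j _
      have := hv j
      simp only [heatFlow_zero]
      linarith
    · intro s _ hall j _ hj
      have : 0 ≤ lapCLM N m a (heatFlow N m a s v) j := by
        rw [lapCLM_apply hmN]
        refine Finset.sum_nonneg fun k hk => mul_nonneg ?_ ?_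
        · have := ha k hk
          positivity
        · have h1 := hall (clampFin N ((j : ℕ) + k)) (Finset.mem_univ _)
          have h2 := hall (clampFin N ((j : ℕ) - k)) (Finset.mem_univ _)
          linarith
      linarith
  by_contra! hneg
  have h1 : 0 < 1 + t := by linarith
  have := key (-heatFlow N m a t v i / (2 * (1 + t))) (by apply div_pos <;> linarith)
  have h2 : -heatFlow N m a t v i / (2 * (1 + t)) * (1 + t) = -heatFlow N m a t v i / 2 := by
    field_simp
  linarith

/-! ### Siegmund duality. -/

/-- The indicator of `⟦y,N⟧` on `⟦0,N⟧`. -/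
def upperInd (N : ℕ) (y : ℤ) (i : Fin (N + 1)) : ℝ := if y ≤ ((i : ℕ) : ℤ) then 1 else 0

/-- For `1 ≤ y ≤ N`, clamping never changes whether a point is `≥ y`. A jump of the point by `k` is
therefore a shift of the threshold by `-k`, with no truncation left. -/
theorem lapCLM_upperInd {N m : ℕ} (hmN : 2 * m ≤ N + 1) (a : ℕ → ℝ) {y : ℤ} (h1 : 1 ≤ y)
    (hN : y ≤ N) :
    lapCLM N m a (upperInd N y) = ∑ k ∈ Finset.Icc 1 m, ((N : ℝ) ^ 2 * a k / 2) •
      (upperInd N (y + (k : ℤ)) + upperInd N (y - (k : ℤ)) - (2 : ℝ) • upperInd N y) := by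
  funext i
  rw [lapCLM_apply hmN, Finset.sum_apply]
  refine Finset.sum_congr rfl fun k _ => ?_
  have e1 : upperInd N y (clampFin N ((i : ℕ) + k)) = upperInd N (y - k) i := by
    simp only [upperInd, coe_clampFin, clamp]
    congr 1
    rw [eq_iff_iff]
    omega
  have e2 : upperInd N y (clampFin N ((i : ℕ) - k)) = upperInd N (y + k) i := by
    simp only [upperInd, coe_clampFin, clamp]
    congr 1
    rw [eq_iff_iff]
    omega
  simp only [e1, e2, Pi.smul_apply, Pi.add_apply, Pi.sub_apply, smul_eq_mul]
  ring

theorem heatFlow_upperInd_of_nonpos {N m : ℕ} (hmN : 2 * m ≤ N + 1) (a : ℕ → ℝ) {y : ℤ}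
    (hy : y ≤ 0) (t : ℝ) (i : Fin (N + 1)) : heatFlow N m a t (upperInd N y) i = 1 := by
  have hone : ∀ j, upperInd N y j = 1 := fun j => if_pos (by omega)
  have hL : lapCLM N m a (upperInd N y) = 0 := by
    funext j
    rw [lapCLM_apply hmN]
    simp only [hone, Pi.zero_apply]
    exact Finset.sum_eq_zero fun k _ => by ring
  have hd : ∀ s, HasDerivAt (fun s => heatFlow N m a s (upperInd N y)) 0 s := fun s => by
    simpa [hL] using hasDerivAt_heatFlow' N m a (upperInd N y) s
  have := is_const_of_deriv_eq_zero (fun s => (hd s).differentiableAt) (fun s => (hd s).deriv) t 0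
  simp only [heatFlow_zero] at this
  rw [this, hone]

theorem heatFlow_upperInd_of_gt (N m : ℕ) (a : ℕ → ℝ) {y : ℤ}
    (hy : (N : ℤ) < y) (t : ℝ) (i : Fin (N + 1)) : heatFlow N m a t (upperInd N y) i = 0 := by
  have : upperInd N y = 0 := funext fun j => if_neg (by have := j.2; omega)
  rw [this, map_zero, Pi.zero_apply]

theorem single_clampFin_eq {N : ℕ} {y : ℤ} (hy : y ∈ Icc (0 : ℤ) N) :
    (Pi.single (clampFin N y) 1 : Fin (N + 1) → ℝ) = upperInd N y - upperInd N (y + 1) := by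
  obtain ⟨h0, h1⟩ := hy
  funext i
  rw [Pi.single_apply, Pi.sub_apply]
  simp only [upperInd, Fin.ext_iff, clampFin]
  split_ifs <;> first | omega | norm_num

/-- `v t y` solves the heat equation of the symmetric walk on `⟦1,N⟧` with jump rates `c k`,
with boundary value `1` to the left and `0` to the right, and is nonincreasing in `y`. -/
structure IsDirichletFlow (N m : ℕ) (c : ℕ → ℝ) (v : ℝ → ℤ → ℝ) : Prop where
  antitone : ∀ t, 0 ≤ t → Antitone (v t)
  left : ∀ t, 0 ≤ t → ∀ y, y ≤ 0 → v t y = 1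
  right : ∀ t, 0 ≤ t → ∀ y, (N : ℤ) < y → v t y = 0
  heat : ∀ t, 0 ≤ t → ∀ y : ℤ, 1 ≤ y → y ≤ N → HasDerivAt (fun s => v s y)
    (∑ k ∈ Finset.Icc 1 m, c k * (v t (y + k) + v t (y - k) - 2 * v t y)) t

/-- Siegmund duality: the tail of the truncated walk, as a function of the threshold, solves the
Dirichlet problem of the symmetric walk. -/
theorem isDirichletFlow_heatFlow {N m : ℕ} (hmN : 2 * m ≤ N + 1) {a : ℕ → ℝ}
    (ha : ∀ k ∈ Finset.Icc 1 m, 0 ≤ a k) (i : Fin (N + 1)) :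
    IsDirichletFlow N m (fun k => (N : ℝ) ^ 2 * a k / 2)
      (fun t y => heatFlow N m a t (upperInd N y) i) where
  antitone t ht y z hyz := by
    have h := heatFlow_nonneg hmN ha (v := upperInd N y - upperInd N z) (fun j => ?_) ht i
    · rw [map_sub, Pi.sub_apply] at h
      exact sub_nonneg.1 h
    · simp only [Pi.sub_apply, upperInd]
      split_ifs <;> first | omega | norm_num
  left t _ y hy := heatFlow_upperInd_of_nonpos hmN a hy t i
  right t _ y hy := heatFlow_upperInd_of_gt N m a hy t i
  heat t _ y h1 hN := by
    refine ((hasDerivAt_pi.1 (hasDerivAt_heatFlow' N m a (upperInd N y) t)) i).congr_deriv ?_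
    rw [lapCLM_upperInd hmN a h1 hN, map_sum, Finset.sum_apply]
    refine Finset.sum_congr rfl fun k _ => ?_
    simp only [map_smul, map_add, map_sub, Pi.smul_apply, Pi.add_apply, Pi.sub_apply, smul_eq_mul]

/-- The symmetry `y ↦ N + 1 - y` swaps the two boundaries, so the right-edge estimate follows from
the left one. -/
theorem IsDirichletFlow.reflect {N m : ℕ} {c : ℕ → ℝ} {v : ℝ → ℤ → ℝ}
    (hv : IsDirichletFlow N m c v) :
    IsDirichletFlow N m c (fun t y => 1 - v t (N + 1 - y)) where
  antitone t ht y z hyz := by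
    have := hv.antitone t ht (show (N : ℤ) + 1 - z ≤ N + 1 - y by omega)
    simp only
    linarith
  left t ht y hy := by rw [hv.right t ht _ (by omega), sub_zero]
  right t ht y hy := by rw [hv.left t ht _ (by omega), sub_self]
  heat t ht y h1 hN := by
    refine ((hv.heat t ht (N + 1 - y) (by omega) (by omega)).const_sub 1).congr_deriv ?_
    rw [← Finset.sum_neg_distrib]
    refine Finset.sum_congr rfl fun k _ => ?_
    rw [show (N : ℤ) + 1 - (y + k) = N + 1 - y - k by ring,
      show (N : ℤ) + 1 - (y - k) = N + 1 - y + k by ring]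
    ring

end LongRangeHeat

/-! ### The concave barrier. -/

namespace LongRangeHeat

/-- The squared positive part is `C¹`, so the barrier is differentiable in time even where its
parabola meets the plateau. -/
theorem hasDerivAt_max_zero_sq (x : ℝ) :
    HasDerivAt (fun y : ℝ => (max 0 y) ^ 2) (2 * max 0 x) x := by
  rcases lt_trichotomy x 0 with h | rfl | h
  · rw [max_eq_left h.le, mul_zero]
    refine (hasDerivAt_const x (0 : ℝ)).congr_of_eventuallyEq ?_
    filter_upwards [eventually_lt_nhds h] with y hy
    rw [max_eq_left hy.le]
    norm_num
  · rw [max_self, mul_zero, hasDerivAt_iff_isLittleO]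
    simp only [max_self, sub_zero, smul_zero, ne_eq, OfNat.ofNat_ne_zero, not_false_eq_true,
      zero_pow]
    refine Asymptotics.IsBigO.trans_isLittleO (g := fun y : ℝ => y ^ 2) ?_ ?_
    · refine Asymptotics.IsBigO.of_bound 1 (Eventually.of_forall fun y => ?_)
      rw [one_mul, Real.norm_of_nonneg (sq_nonneg _), Real.norm_of_nonneg (sq_nonneg _)]
      rcases le_total 0 y with hy | hy
      · rw [max_eq_right hy]
      · rw [max_eq_left hy]
        nlinarith
    · exact Asymptotics.isLittleO_pow_id one_lt_two
  · rw [max_eq_right h.le]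
    refine HasDerivAt.congr_of_eventuallyEq (f := fun y : ℝ => y ^ 2) ?_ ?_
    · simpa using hasDerivAt_pow 2 x
    · filter_upwards [eventually_gt_nhds h] with y hy
      rw [max_eq_right hy.le]

/-- The radius of the barrier. -/
noncomputable def radius (c t : ℝ) : ℝ := √(1 + 4 * c * t)

/-- A concave supersolution of the heat equation, above `1` away from `0` initially and for
`e ≥ N` at all times. -/
noncomputable def barrier (N : ℕ) (c t e : ℝ) : ℝ :=
  e / N + (1 - (max 0 (1 - e / radius c t)) ^ 2)

theorem one_le_radius {c t : ℝ} (hc : 0 ≤ c) (ht : 0 ≤ t) : 1 ≤ radius c t := by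
  rw [radius, Real.one_le_sqrt]
  nlinarith [mul_nonneg hc ht]

theorem barrier_mono (N : ℕ) {c t e e' : ℝ} (hc : 0 ≤ c) (ht : 0 ≤ t) (h : e ≤ e') :
    barrier N c t e ≤ barrier N c t e' := by
  have hr := zero_lt_one.trans_le (one_le_radius hc ht)
  unfold barrier
  gcongr

theorem sq_max_le_one {c t e : ℝ} (hc : 0 ≤ c) (ht : 0 ≤ t) (he : 0 ≤ e) :
    (max 0 (1 - e / radius c t)) ^ 2 ≤ 1 := by
  have hr := zero_lt_one.trans_le (one_le_radius hc ht)
  refine pow_le_one₀ (le_max_left _ _) (max_le zero_le_one ?_)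
  linarith [div_nonneg he hr.le]

theorem barrier_nonneg (N : ℕ) {c t e : ℝ} (hc : 0 ≤ c) (ht : 0 ≤ t) (he : 0 ≤ e) :
    0 ≤ barrier N c t e := by
  have := sq_max_le_one hc ht he
  have h2 : 0 ≤ e / N := by positivity
  unfold barrier
  linarith

theorem one_le_barrier {N : ℕ} (hN : 1 ≤ N) {c t e : ℝ} (hc : 0 ≤ c) (ht : 0 ≤ t)
    (he : (N : ℝ) ≤ e) : 1 ≤ barrier N c t e := by
  have hN' : (0 : ℝ) < N := by exact_mod_cast hN
  have := sq_max_le_one hc ht (hN'.le.trans he)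
  have h2 : 1 ≤ e / N := by rwa [one_le_div hN']
  unfold barrier
  linarith

theorem one_le_barrier_zero (N : ℕ) {c e : ℝ} (he : 1 ≤ e) : 1 ≤ barrier N c 0 e := by
  have h2 : 0 ≤ e / N := by positivity
  have h3 : max 0 (1 - e) = 0 := max_eq_left (by linarith)
  simp only [barrier, radius, mul_zero, add_zero, Real.sqrt_one, div_one, h3]
  linarith

theorem barrier_le (N : ℕ) (c t e : ℝ) : barrier N c t e ≤ e / N + 2 * (e / radius c t) := by
  unfold barrier
  rcases le_total 0 (1 - e / radius c t) with h | h
  · rw [max_eq_right h]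
    nlinarith [sq_nonneg (e / radius c t)]
  · rw [max_eq_left h]
    linarith

/-- The squared positive part is convex on the whole line, so no sign condition on `e` or `e ± s` is
needed. -/
theorem barrier_concave (N : ℕ) {c t : ℝ} (hc : 0 ≤ c) (ht : 0 ≤ t) (e s : ℝ) :
    barrier N c t (e + s) + barrier N c t (e - s) - 2 * barrier N c t e ≤ 0 := by
  have hr := zero_lt_one.trans_le (one_le_radius hc ht)
  set q := s / radius c t
  set x := 1 - e / radius c t with hx
  have h1 : 1 - (e + s) / radius c t = x - q := by rw [add_div]; ring
  have h2 : 1 - (e - s) / radius c t = x + q := by rw [sub_div]; ring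
  have key : 2 * (max 0 x) ^ 2 ≤ (max 0 (x - q)) ^ 2 + (max 0 (x + q)) ^ 2 := by
    rcases le_total x 0 with h | h
    · rw [max_eq_left h]
      nlinarith [sq_nonneg (max 0 (x - q)), sq_nonneg (max 0 (x + q))]
    · rw [max_eq_right h]
      have h3 := le_max_right 0 (x - q)
      have h4 := le_max_right 0 (x + q)
      have h5 : 2 * x ≤ max 0 (x - q) + max 0 (x + q) := by linarith
      nlinarith [sq_nonneg (max 0 (x - q) - max 0 (x + q)), mul_self_le_mul_self (by linarith) h5]
  unfold barrier
  rw [h1, h2, add_div, sub_div]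
  linarith

/-- The time derivative of the barrier. -/
noncomputable def barrierDeriv (c t e : ℝ) : ℝ :=
  -(4 * c * (max 0 (1 - e / radius c t)) * e / radius c t ^ 3)

theorem hasDerivAt_barrier (N : ℕ) {c t : ℝ} (hc : 0 ≤ c) (ht : 0 ≤ t) (e : ℝ) :
    HasDerivAt (fun s => barrier N c s e) (barrierDeriv c t e) t := by
  have hr := zero_lt_one.trans_le (one_le_radius hc ht)
  have hpos : (0 : ℝ) < 1 + 4 * c * t := by nlinarith [mul_nonneg hc ht]
  have h1 : HasDerivAt (fun s => radius c s) (4 * c / (2 * radius c t)) t := by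
    have := (((hasDerivAt_id t).const_mul (4 * c)).const_add 1).sqrt hpos.ne'
    simpa [radius] using this
  have h2 : HasDerivAt (fun s => 1 - e / radius c s)
      (-((0 * radius c t - e * (4 * c / (2 * radius c t))) / radius c t ^ 2)) t :=
    ((hasDerivAt_const t e).div h1 hr.ne').const_sub 1
  have h3 := (((hasDerivAt_max_zero_sq _).comp t h2).const_sub 1).const_add (e / N)
  refine h3.congr_deriv ?_
  rw [barrierDeriv]
  field_simp
  ring

/-- With `u = e / r ≤ 1`, the second difference is at most `-(s / r)² ≤ -1 / r²`, while `r' = 2 * c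
/ r` makes the time derivative `-4 * c * u * (1 - u) / r² ≥ -c / r²`. Beyond the radius the time
derivative vanishes and concavity suffices. -/
theorem barrier_supersolution (N : ℕ) {c t : ℝ} (hc : 0 ≤ c) (ht : 0 ≤ t) (e : ℝ) {s : ℝ}
    (hs : 1 ≤ s) :
    c * (barrier N c t (e + s) + barrier N c t (e - s) - 2 * barrier N c t e) ≤
      barrierDeriv c t e := by
  have hr := zero_lt_one.trans_le (one_le_radius hc ht)
  rcases le_total (1 - e / radius c t) 0 with h | h
  · rw [barrierDeriv, max_eq_left h]
    simpa using mul_nonpos_of_nonneg_of_nonpos hc (barrier_concave N hc ht e s)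
  set r := radius c t with hrdef
  have h1 : 1 - (e + s) / r = 1 - e / r - s / r := by rw [add_div]; ring
  have h2 : 1 - (e - s) / r = 1 - e / r + s / r := by rw [sub_div]; ring
  have hq : 1 / r ≤ s / r := by gcongr
  have hq0 : 0 < 1 / r := by positivity
  have hD : barrierDeriv c t e = -(c * (4 * (1 - e / r) * (e / r) * (1 / r) ^ 2)) := by
    rw [barrierDeriv, ← hrdef, max_eq_right h]
    field_simp
  have h3 : (1 / r) ^ 2 ≤ (s / r) ^ 2 := by gcongr
  have h4 : 4 * (1 - e / r) * (e / r) * (1 / r) ^ 2 ≤ (1 / r) ^ 2 := by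
    have : 4 * (1 - e / r) * (e / r) ≤ 1 := by nlinarith [sq_nonneg (2 * (e / r) - 1)]
    nlinarith [sq_nonneg (1 / r)]
  have h5 : (s / r) ^ 2 ≤ (max 0 (1 - e / r - s / r)) ^ 2 + (max 0 (1 - e / r + s / r)) ^ 2
      - 2 * (1 - e / r) ^ 2 := by
    rw [max_eq_right (a := 0) (b := 1 - e / r + s / r) (by linarith)]
    rcases le_total 0 (1 - e / r - s / r) with h' | h'
    · rw [max_eq_right h']
      nlinarith [sq_nonneg (s / r)]
    · rw [max_eq_left h']
      nlinarith
  rw [hD, ← mul_neg]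
  refine mul_le_mul_of_nonneg_left ?_ hc
  unfold barrier
  rw [← hrdef, h1, h2, add_div, sub_div, max_eq_right h]
  linarith

/-! ### Comparison of the Dirichlet flow with the barrier. -/

/-- Boundary estimate at the left edge. -/
theorem IsDirichletFlow.one_sub_le_barrier {N m : ℕ} (hN : 1 ≤ N) (hm : 1 ≤ m) {c : ℕ → ℝ}
    (hc : ∀ k ∈ Finset.Icc 1 m, 0 ≤ c k) {v : ℝ → ℤ → ℝ} (hv : IsDirichletFlow N m c v) {t : ℝ}
    (ht : 0 ≤ t) {z : ℤ} (h1 : 1 ≤ z) : 1 - v t z ≤ barrier N (c 1) t (z + m) := by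
  have hc1 : 0 ≤ c 1 := hc 1 (Finset.mem_Icc.2 ⟨le_rfl, hm⟩)
  have hpos : ∀ s, 0 ≤ s → ∀ y, 0 ≤ v s y := fun s hs y => by
    rw [← hv.right s hs (max y (N + 1)) (by omega)]
    exact hv.antitone s hs (le_max_left _ _)
  have hout : ∀ s, 0 ≤ s → ∀ y : ℤ, (N : ℤ) < y → 1 - v s y ≤ barrier N (c 1) s (y + m) := by
    intro s hs y hy
    have : (N : ℝ) ≤ (y : ℝ) + m := by
      have : (N : ℤ) ≤ y + m := by omega
      exact_mod_cast this
    linarith [hpos s hs y, one_le_barrier hN hc1 hs this]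
  by_cases hzN : z ≤ N
  swap
  · exact hout t ht z (by omega)
  refine le_of_forall_pos_le_add fun δ hδ => ?_
  have ht1 : 0 < 1 + t := by linarith
  set ε := δ / (1 + t) with hε
  have hε0 : 0 < ε := by positivity
  have hεt : ε * (1 + t) = δ := by rw [hε]; field_simp
  suffices h : 1 - v t z - barrier N (c 1) t (z + m) - ε * (1 + t) ≤ 0 by linarith
  refine nonpos_of_forall_deriv_neg (Finset.Icc (1 : ℤ) N)
    (fun y s => 1 - v s y - barrier N (c 1) s (y + m) - ε * (1 + s))
    (fun y s => -(∑ k ∈ Finset.Icc 1 m, c k * (v s (y + k) + v s (y - k) - 2 * v s y))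
      - barrierDeriv (c 1) s (y + m) - ε) ?_ ?_ ?_ ht (Finset.mem_Icc.2 ⟨h1, hzN⟩)
  · intro s hs y hy
    rw [Finset.mem_Icc] at hy
    have h := (((hv.heat s hs y hy.1 hy.2).const_sub 1).sub
      (hasDerivAt_barrier N hc1 hs ((y : ℝ) + m))).sub
      (((hasDerivAt_id s).const_add 1).const_mul ε)
    exact h.congr_deriv (by simp)
  · intro y hy
    rw [Finset.mem_Icc] at hy
    have h2 : (1 : ℝ) ≤ (y : ℝ) + m := by
      have : (1 : ℤ) ≤ y + m := by omega
      exact_mod_cast this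
    have := one_le_barrier_zero N (c := c 1) h2
    have := hpos 0 le_rfl y
    linarith
  · intro s hs hall y hy hy0
    rw [Finset.mem_Icc] at hy
    have hs1 : 0 ≤ ε * (1 + s) := by positivity
    -- Jumps from `y ≥ 1` land no lower than `1 - m`. There `1 - v` vanishes, and the shift by `m`
    -- keeps the argument of the barrier nonnegative.
    have hle : ∀ x : ℤ, 1 - (m : ℤ) ≤ x →
        1 - v s x ≤ barrier N (c 1) s (x + m) + ε * (1 + s) := by
      intro x hx
      rcases lt_or_ge x 1 with hx1 | hx1
      · have h2 : (0 : ℝ) ≤ (x : ℝ) + m := by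
          have : (0 : ℤ) ≤ x + m := by omega
          exact_mod_cast this
        rw [hv.left s hs x (by omega)]
        linarith [barrier_nonneg N hc1 hs h2]
      · rcases le_or_gt x N with hx2 | hx2
        · linarith [hall x (Finset.mem_Icc.2 ⟨hx1, hx2⟩)]
        · linarith [hout s hs x hx2]
    -- Equality holds at the contact point `y`, and the slack cancels in second differences.
    have hk : ∀ k ∈ Finset.Icc 1 m, -(v s (y + k) + v s (y - k) - 2 * v s y) ≤
        barrier N (c 1) s (y + m + k) + barrier N (c 1) s (y + m - k)
          - 2 * barrier N (c 1) s (y + m) := by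
      intro k hk
      rw [Finset.mem_Icc] at hk
      have e1 := hle (y + k) (by omega)
      have e2 := hle (y - k) (by omega)
      push_cast at e1 e2
      rw [show (y : ℝ) + k + m = y + m + k by ring] at e1
      rw [show (y : ℝ) - k + m = y + m - k by ring] at e2
      linarith
    have hsum : -(∑ k ∈ Finset.Icc 1 m, c k * (v s (y + k) + v s (y - k) - 2 * v s y)) ≤
        barrierDeriv (c 1) s (y + m) := by
      rw [← Finset.sum_neg_distrib, ← Finset.add_sum_erase _ _ (Finset.mem_Icc.2 ⟨le_rfl, hm⟩)]
      have e1 : ∑ k ∈ (Finset.Icc 1 m).erase 1, -(c k * (v s (y + k) + v s (y - k) - 2 * v s y))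
          ≤ 0 := by
        refine Finset.sum_nonpos fun k hk' => ?_
        have hk' := Finset.mem_of_mem_erase hk'
        rw [← mul_neg]
        exact mul_nonpos_of_nonneg_of_nonpos (hc k hk')
          ((hk k hk').trans (barrier_concave N hc1 hs _ _))
      have e2 := mul_le_mul_of_nonneg_left (hk 1 (Finset.mem_Icc.2 ⟨le_rfl, hm⟩)) hc1
      have e3 := barrier_supersolution N hc1 hs ((y : ℝ) + m) le_rfl
      push_cast at e1 e2 ⊢
      linarith
    linarith

/-- The modulus of continuity estimate for the Dirichlet flow. -/
theorem IsDirichletFlow.sub_le_barrier {N m : ℕ} (hN : 1 ≤ N) (hm : 1 ≤ m) {c : ℕ → ℝ}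
    (hc : ∀ k ∈ Finset.Icc 1 m, 0 ≤ c k) {v : ℝ → ℤ → ℝ} (hv : IsDirichletFlow N m c v) {t : ℝ}
    (ht : 0 ≤ t) {y z : ℤ} (hyz : y < z) :
    v t y - v t z ≤ barrier N (c 1) t (z - y + m) := by
  have hc1 : 0 ≤ c 1 := hc 1 (Finset.mem_Icc.2 ⟨le_rfl, hm⟩)
  have hpos : ∀ s, 0 ≤ s → ∀ y, 0 ≤ v s y := fun s hs y => by
    rw [← hv.right s hs (max y (N + 1)) (by omega)]
    exact hv.antitone s hs (le_max_left _ _)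
  have hle1 : ∀ s, 0 ≤ s → ∀ y, v s y ≤ 1 := fun s hs y => by
    rw [← hv.left s hs (min y 0) (min_le_right _ _)]
    exact hv.antitone s hs (min_le_left _ _)
  have hout : ∀ s, 0 ≤ s → ∀ y z : ℤ, y < z → ¬ (1 ≤ y ∧ z ≤ N) →
      v s y - v s z ≤ barrier N (c 1) s (z - y + m) := by
    intro s hs y z hyz hn
    have hyz' : (y : ℝ) + 1 ≤ z := by exact_mod_cast hyz
    have h0 : (0 : ℝ) ≤ m := m.cast_nonneg
    rcases le_or_gt y 0 with hy | hy
    · have hy' : (y : ℝ) ≤ 0 := by exact_mod_cast hy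
      rw [hv.left s hs y hy]
      rcases le_or_gt z 0 with hz | hz
      · rw [hv.left s hs z hz, sub_self]
        exact barrier_nonneg N hc1 hs (by linarith)
      · exact (hv.one_sub_le_barrier hN hm hc hs hz).trans
          (barrier_mono N hc1 hs (by linarith))
    · have hz : (N : ℤ) < z := by omega
      have hz' : (N : ℝ) + 1 ≤ z := by exact_mod_cast hz
      rw [hv.right s hs z hz, sub_zero]
      rcases le_or_gt y N with hy2 | hy2
      · have h := hv.reflect.one_sub_le_barrier hN hm hc hs (z := N + 1 - y) (by omega)
        simp only [sub_sub_cancel] at h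
        refine h.trans (barrier_mono N hc1 hs ?_)
        push_cast
        linarith
      · rw [hv.right s hs y hy2]
        exact barrier_nonneg N hc1 hs (by linarith)
  by_cases hin : 1 ≤ y ∧ z ≤ N
  swap
  · exact hout t ht y z hyz hin
  refine le_of_forall_pos_le_add fun δ hδ => ?_
  have ht1 : 0 < 1 + t := by linarith
  set ε := δ / (1 + t) with hε
  have hε0 : 0 < ε := by positivity
  have hεt : ε * (1 + t) = δ := by rw [hε]; field_simp
  suffices h : v t y - v t z - barrier N (c 1) t (z - y + m) - ε * (1 + t) ≤ 0 by linarith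
  have hmem : ∀ p : ℤ × ℤ,
      p ∈ ((Finset.Icc (1 : ℤ) N) ×ˢ (Finset.Icc (1 : ℤ) N)).filter (fun p => p.1 < p.2) ↔
        (1 ≤ p.1 ∧ p.2 ≤ N) ∧ p.1 < p.2 := by
    intro p
    simp only [Finset.mem_filter, Finset.mem_product, Finset.mem_Icc]
    omega
  refine nonpos_of_forall_deriv_neg
    (((Finset.Icc (1 : ℤ) N) ×ˢ (Finset.Icc (1 : ℤ) N)).filter (fun p => p.1 < p.2))
    (fun p s => v s p.1 - v s p.2 - barrier N (c 1) s (p.2 - p.1 + m) - ε * (1 + s))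
    (fun p s => (∑ k ∈ Finset.Icc 1 m, c k * (v s (p.1 + k) + v s (p.1 - k) - 2 * v s p.1))
      - (∑ k ∈ Finset.Icc 1 m, c k * (v s (p.2 + k) + v s (p.2 - k) - 2 * v s p.2))
      - barrierDeriv (c 1) s (p.2 - p.1 + m) - ε) ?_ ?_ ?_ ht (i := (y, z)) ((hmem _).2 ⟨hin, hyz⟩)
  · rintro s hs ⟨y, z⟩ hp
    obtain ⟨⟨hy, hz⟩, hyz⟩ := (hmem _).1 hp
    simp only at hy hz hyz
    have h := (((hv.heat s hs y hy (by omega)).sub (hv.heat s hs z (by omega) hz)).sub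
      (hasDerivAt_barrier N hc1 hs ((z : ℝ) - y + m))).sub
      (((hasDerivAt_id s).const_add 1).const_mul ε)
    exact h.congr_deriv (by simp)
  · rintro ⟨y, z⟩ hp
    obtain ⟨⟨hy, hz⟩, hyz⟩ := (hmem _).1 hp
    simp only at hy hz hyz
    have h2 : (1 : ℝ) ≤ (z : ℝ) - y + m := by
      have : (1 : ℤ) ≤ z - y + m := by omega
      exact_mod_cast this
    have := one_le_barrier_zero N (c := c 1) h2
    have := hpos 0 le_rfl z
    have := hle1 0 le_rfl y
    simp only
    linarith
  · rintro s hs hall ⟨y, z⟩ hp hp0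
    obtain ⟨⟨hy, hz⟩, hyz⟩ := (hmem _).1 hp
    simp only at hy hz hyz hp0 ⊢
    have hs1 : 0 ≤ ε * (1 + s) := by positivity
    have hm' : (1 : ℝ) ≤ m := by exact_mod_cast hm
    have hle : ∀ x x' : ℤ, x < x' →
        v s x - v s x' ≤ barrier N (c 1) s (x' - x + m) + ε * (1 + s) := by
      intro x x' hx
      by_cases hin : 1 ≤ x ∧ x' ≤ N
      · linarith [hall (x, x') ((hmem _).2 ⟨hin, hx⟩)]
      · linarith [hout s hs x x' hx hin]
    -- Parallel moves of the pair preserve `z - y`, hence the barrier value, so contact forces the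
    -- sign.
    have hk : ∀ k ∈ Finset.Icc 1 m, v s (y + k) + v s (y - k) - 2 * v s y
        - (v s (z + k) + v s (z - k) - 2 * v s z) ≤ 0 := by
      intro k _
      have e1 := hle (y + k) (z + k) (by omega)
      have e2 := hle (y - k) (z - k) (by omega)
      push_cast at e1 e2
      rw [show (z : ℝ) + k - (y + k) = z - y by ring] at e1
      rw [show (z : ℝ) - k - (y - k) = z - y by ring] at e2
      linarith
    -- Mirror moves: regrouping pairs `y - 1` with `z + 1` and `y + 1` with `z - 1`, which changes
    -- the distance by `±2`.
    have hone : v s (y + 1) + v s (y - 1) - 2 * v s y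
        - (v s (z + 1) + v s (z - 1) - 2 * v s z) ≤
        barrier N (c 1) s (z - y + m + 2) + barrier N (c 1) s (z - y + m - 2)
          - 2 * barrier N (c 1) s (z - y + m) := by
      have e1 := hle (y - 1) (z + 1) (by omega)
      have e2 : v s (y + 1) - v s (z - 1) ≤
          barrier N (c 1) s (z - y + m - 2) + ε * (1 + s) := by
        rcases lt_or_ge (y + 1) (z - 1) with h | h
        · have e := hle (y + 1) (z - 1) h
          push_cast at e
          rwa [show (z : ℝ) - 1 - (y + 1) + m = z - y + m - 2 by ring] at e
        -- When the points meet or cross, monotonicity makes the difference nonpositive, and `z - y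
        -- + m - 2 ≥ 0` because `m ≥ 1`.
        · have e := hv.antitone s hs h
          have hyz' : (y : ℝ) + 1 ≤ z := by exact_mod_cast hyz
          linarith [barrier_nonneg N hc1 hs (e := (z : ℝ) - y + m - 2) (by linarith)]
      push_cast at e1
      rw [show (z : ℝ) + 1 - (y - 1) + m = z - y + m + 2 by ring] at e1
      linarith
    have hsum : (∑ k ∈ Finset.Icc 1 m, c k * (v s (y + k) + v s (y - k) - 2 * v s y))
        - (∑ k ∈ Finset.Icc 1 m, c k * (v s (z + k) + v s (z - k) - 2 * v s z)) ≤
        barrierDeriv (c 1) s (z - y + m) := by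
      rw [← Finset.sum_sub_distrib, ← Finset.add_sum_erase _ _ (Finset.mem_Icc.2 ⟨le_rfl, hm⟩)]
      have e1 : ∑ k ∈ (Finset.Icc 1 m).erase 1, (c k * (v s (y + k) + v s (y - k) - 2 * v s y)
          - c k * (v s (z + k) + v s (z - k) - 2 * v s z)) ≤ 0 := by
        refine Finset.sum_nonpos fun k hk' => ?_
        have hk' := Finset.mem_of_mem_erase hk'
        rw [← mul_sub]
        exact mul_nonpos_of_nonneg_of_nonpos (hc k hk') (hk k hk')
      have e2 := mul_le_mul_of_nonneg_left hone hc1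
      have e3 := barrier_supersolution N hc1 hs ((z : ℝ) - y + m) one_le_two
      push_cast at e1 e2 ⊢
      linarith
    linarith

end LongRangeHeat

/-! ### The heat kernel bound. -/

theorem mainTheorem2 :
    ∃ C : ℕ → ℝ → ℝ → ℝ,
      ∀ (N m : ℕ) (lam : ℝ) (α : ℕ → ℝ) (Tf : ℝ) (U : ℝ → ℝ → ℤ → ℤ → ℝ),
        1 ≤ m → 2 * m ≤ N + 1 →
        (∀ k ∈ Finset.Icc 1 m, 0 < α k) →
        0 < LongRangeHeat.alphaTilde N m lam α 1 →
        (∀ k ∈ Finset.Icc 1 m, 0 ≤ LongRangeHeat.alphaTilde N m lam α k) →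
        LongRangeHeat.IsNeumannHeatKernel N m (LongRangeHeat.alphaTilde N m lam α) U →
        ∀ S T : ℝ, 0 ≤ S → S ≤ T → T ≤ Tf →
          ∀ x ∈ Set.Icc (0 : ℤ) N, ∀ y ∈ Set.Icc (0 : ℤ) N,
            0 ≤ U S T x y ∧
            U S T x y ≤
              C m (LongRangeHeat.alphaTilde N m lam α 1) Tf * LongRangeHeat.envelope N S T := by
  -- The factor `m + 1` is the barrier's argument at `z = y + 1`, and `2 / √a1` comes from its slope
  -- `2 / r` with `r ≥ N * √a1 * √(T - S)`. The added `1` covers the `N⁻¹` term and the cutoff at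
  -- `1`.
  refine ⟨fun m a1 _ => (m + 1) * (1 + 2 / √a1), ?_⟩
  intro N m lam α Tf U hm hmN _ ha1 ha hU S T hS hST _ x hx y hy
  set a := LongRangeHeat.alphaTilde N m lam α
  have hN : 1 ≤ N := by omega
  have hN0 : (0 : ℝ) < N := by exact_mod_cast hN
  have ht : 0 ≤ T - S := sub_nonneg.2 hST
  have hv := LongRangeHeat.isDirichletFlow_heatFlow hmN ha (LongRangeHeat.clampFin N x)
  have hUv : U S T x y =
      LongRangeHeat.heatFlow N m a (T - S) (LongRangeHeat.upperInd N y)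
        (LongRangeHeat.clampFin N x) -
      LongRangeHeat.heatFlow N m a (T - S) (LongRangeHeat.upperInd N (y + 1))
        (LongRangeHeat.clampFin N x) := by
    rw [hU.eq_heatFlow hmN hS hST hx hy, LongRangeHeat.single_clampFin_eq hy, map_sub,
      Pi.sub_apply]
  have hsq : 0 < √(a 1) := Real.sqrt_pos.2 ha1
  have hdiv : 0 ≤ 2 / √(a 1) := by positivity
  have hm0 : (0 : ℝ) ≤ m := m.cast_nonneg
  have hC1 : 1 ≤ ((m : ℝ) + 1) * (1 + 2 / √(a 1)) := by nlinarith
  have hU1 : U S T x y ≤ 1 := by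
    have e1 := hv.antitone _ ht hy.1
    have e2 := hv.antitone _ ht (show y + 1 ≤ N + 1 by have := hy.2; omega)
    simp only [hv.left _ ht 0 le_rfl] at e1
    simp only [hv.right _ ht (N + 1) (by omega)] at e2
    linarith
  refine ⟨?_, ?_⟩
  · rw [hUv]
    exact sub_nonneg.2 (hv.antitone _ ht (by omega))
  unfold LongRangeHeat.envelope
  split_ifs with hEq
  · linarith
  rw [mul_min_of_nonneg _ _ (by linarith), mul_one]
  refine le_min ?_ (hU1.trans hC1)
  have htpos : 0 < T - S := lt_of_le_of_ne ht (fun h => hEq (by linarith))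
  have hrpow : |T - S| ^ (-(1 / 2) : ℝ) = 1 / √(T - S) := by
    rw [abs_of_pos htpos, Real.rpow_neg ht, ← Real.sqrt_eq_rpow, one_div]
  have hc : ∀ k ∈ Finset.Icc 1 m, 0 ≤ (N : ℝ) ^ 2 * a k / 2 := fun k hk => by
    have := ha k hk
    positivity
  have hb := (hv.sub_le_barrier hN hm hc ht (lt_add_one y)).trans
    (LongRangeHeat.barrier_le _ _ _ _)
  push_cast at hb
  rw [← hUv, add_sub_cancel_left, add_comm 1 (m : ℝ)] at hb
  have hr : N * √(a 1) * √(T - S) ≤ LongRangeHeat.radius ((N : ℝ) ^ 2 * a 1 / 2) (T - S) := by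
    rw [LongRangeHeat.radius]
    apply Real.le_sqrt_of_sq_le
    rw [mul_pow, mul_pow, Real.sq_sqrt ha1.le, Real.sq_sqrt ht]
    have : 0 ≤ (N : ℝ) ^ 2 * a 1 * (T - S) := by positivity
    linarith
  have hst : 0 < √(T - S) := Real.sqrt_pos.2 htpos
  have h1 : ((m : ℝ) + 1) / LongRangeHeat.radius ((N : ℝ) ^ 2 * a 1 / 2) (T - S) ≤
      (m + 1) / (N * √(a 1) * √(T - S)) := by gcongr
  rw [hrpow]
  calc U S T x y ≤ (m + 1) / N + 2 * ((m + 1) / (N * √(a 1) * √(T - S))) := by linarith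
    _ = (m + 1) * ((N : ℝ)⁻¹ + 2 / √(a 1) * ((N : ℝ)⁻¹ * (1 / √(T - S)))) := by
      field_simp
    -- The added nonnegative cross terms complete the product of `1 + 2 / √(a 1)` with the envelope.
    _ ≤ (m + 1) * ((N : ℝ)⁻¹ + 2 / √(a 1) * ((N : ℝ)⁻¹ * (1 / √(T - S))) +
        (2 / √(a 1) * (N : ℝ)⁻¹ + (N : ℝ)⁻¹ * (1 / √(T - S)))) := by
      refine mul_le_mul_of_nonneg_left ?_ (by positivity)
      exact le_add_of_nonneg_right (by positivity)
    _ = _ := by ring
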